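/- **Theorem (Encoding first-order finite satisfiability).** A *multi-sorted Term Coding system* $\Gamma$ consists of a finite signature of function symbols (constants included), each with a tuple of input sorts and an output sort, finitely many sorted variables, a finite set of term equations $s=t$ and a finite set of non-equality constraints $s\neq t$, where $s,t$ are well-sorted terms of the same sort. An *interpretation* assigns a non-empty finite domain to each sort and a function between the corresponding domains to each function symbol; it is a *model* of $\Gamma$ if all the equations and all the non-equality constraints hold under every assignment of the variables. There is an effective translation (a computable function on the usual codes of finite syntactic objects, uniform in the signature) that maps each first-order sentence $\psi$, possibly with equality, over a finite relational signature $\Sigma$ to a multi-sorted Term Coding system $\Gamma_\psi$ with two sorts, a primary sort and an auxiliary sort $\mathsf{Bool}$, over a signature $\Sigma'$ that contains, for each relation symbol of $\Sigma$ of arity $k$, a function symbol from $k$-tuples of the primary sort to $\mathsf{Bool}$, such that for every integer $n\ge 2$: $\psi$ has a model whose domain has exactly $n$ elements if and only if $\Gamma_\psi$ has a model in which the domain of the primary sort has exactly $n$ elements and the domain of $\mathsf{Bool}$ has exactly $2$ elements. -/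

import Mathlib

open scoped FirstOrder

namespace TermCoding

/-! ### Finite relational signatures and codes of first-order sentences -/

/-- The relational language with relation symbols `R_0, …, R_{m-1}`, where `ar = [k_0, …, k_{m-1}]`
and `R_i` has arity `k_i`.  There are no function symbols. -/
def relLang (ar : List ℕ) : FirstOrder.Language.{0, 0} where
  Functions _ := Empty
  Relations k := {i : Fin ar.length // ar.get i = k}

/-- In a relational language without free variables, a term in the scope of `n` quantifiers is one
of the bound variables `x_0, …, x_{n-1}`; this is its index. -/
def varIndex {ar : List ℕ} {n : ℕ} : (relLang ar).Term (Empty ⊕ Fin n) → ℕ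
  | .var (.inl e) => e.elim
  | .var (.inr i) => i
  | .func f _ => Empty.elim f

/-- The code of a formula: its Polish notation, as a list of tokens.  The tokens are
`(0, [])` for `⊥`, `(1, [i, j])` for `x_i = x_j`, `(2, [r, i_1, …, i_k])` for
`R_r(x_{i_1}, …, x_{i_k})`, `(3, [])` for `→` (followed by its two arguments), and
`(4, [n])` for `∀ x_n` (followed by its scope). -/
def formulaCode {ar : List ℕ} : {n : ℕ} → (relLang ar).BoundedFormula Empty n → List (ℕ × List ℕ)
  | _, .falsum => [(0, [])]
  | _, .equal t₁ t₂ => [(1, [varIndex t₁, varIndex t₂])]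
  | _, .rel R ts => [(2, (R.1 : ℕ) :: List.ofFn fun j => varIndex (ts j))]
  | _, .imp φ₁ φ₂ => (3, []) :: (formulaCode φ₁ ++ formulaCode φ₂)
  | n, .all φ => (4, [n]) :: formulaCode φ

/-- `ψ` has a model whose domain has exactly `n` elements. -/
def HasModelOfSize {ar : List ℕ} (ψ : (relLang ar).Sentence) (n : ℕ) : Prop :=
  ∃ (M : Type) (_ : (relLang ar).Structure M), Nat.card M = n ∧ M ⊨ ψ

/-! ### Multi-sorted term languages and Term Coding systems -/

/-- A finite many-sorted functional signature over the sorts `σ`: the list of the function symbols,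
each given by its tuple of input sorts and its output sort.  Constants have no input sorts. -/
abbrev Signature (σ : Type) : Type := List (List σ × σ)

/-- The input sorts of the `f`-th function symbol. -/
abbrev Signature.dom {σ : Type} (S : Signature σ) (f : Fin S.length) : List σ := (S.get f).1

/-- The output sort of the `f`-th function symbol. -/
abbrev Signature.cod {σ : Type} (S : Signature σ) (f : Fin S.length) : σ := (S.get f).2

/-- Well-sorted terms over the signature `S` in the variables `x_0, …, x_{v-1}`, where
`vars` lists the sorts of the variables; the index is the sort of the term. -/
inductive STerm {σ : Type} (S : Signature σ) (vars : List σ) : σ → Type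
  | var (i : Fin vars.length) : STerm S vars (vars.get i)
  | app (f : Fin S.length)
      (args : (j : Fin (S.dom f).length) → STerm S vars ((S.dom f).get j)) :
      STerm S vars (S.cod f)

/-- A pair of terms of the same sort: the two sides of a term equation
or of a non-equality constraint. -/
structure TermPair {σ : Type} (S : Signature σ) (vars : List σ) : Type where
  /-- the common sort -/
  sort : σ
  /-- the left-hand side -/
  lhs : STerm S vars sort
  /-- the right-hand side -/
  rhs : STerm S vars sort

/-- A multi-sorted Term Coding system over the sorts `σ`: a finite signature, finitely many sorted
variables, a finite set of term equations and a finite set of non-equality constraints. -/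
structure TermCodingSystem (σ : Type) : Type where
  /-- the function symbols -/
  sig : Signature σ
  /-- the sorts of the variables -/
  vars : List σ
  /-- the term equations `lhs = rhs` -/
  equations : List (TermPair sig vars)
  /-- the non-equality constraints `lhs ≠ rhs` -/
  nonEqualities : List (TermPair sig vars)

/-- An interpretation: a non-empty finite domain for each sort, and a function between the right
domains for each function symbol. -/
structure Interpretation {σ : Type} (S : Signature σ) : Type 1 where
  /-- the domain of each sort -/
  carrier : σ → Type
  finite_carrier : ∀ s, Finite (carrier s)
  nonempty_carrier : ∀ s, Nonempty (carrier s)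
  /-- the functions that interpret the symbols -/
  interp : (f : Fin S.length) → ((j : Fin (S.dom f).length) → carrier ((S.dom f).get j)) →
    carrier (S.cod f)

/-- The value of a term under an assignment of the variables. -/
def STerm.eval {σ : Type} {S : Signature σ} {vars : List σ} (I : Interpretation S)
    (a : (i : Fin vars.length) → I.carrier (vars.get i)) :
    {s : σ} → STerm S vars s → I.carrier s
  | _, .var i => a i
  | _, .app f args => I.interp f fun j => (args j).eval I a

/-- `I` is a model of the system: under every assignment of the variables all the equations and all
the non-equality constraints hold. -/
def TermCodingSystem.IsModel {σ : Type} (Γ : TermCodingSystem σ) (I : Interpretation Γ.sig) : Prop :=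
  ∀ a : (i : Fin Γ.vars.length) → I.carrier (Γ.vars.get i),
    (∀ e ∈ Γ.equations, e.lhs.eval I a = e.rhs.eval I a) ∧
    (∀ e ∈ Γ.nonEqualities, e.lhs.eval I a ≠ e.rhs.eval I a)

/-! ### Codes of Term Coding systems -/

/-- The code of a term: its Polish notation, with the token `(0, i)` for the variable `x_i` and
`(1, f)` for the `f`-th function symbol (followed by its arguments). -/
def STerm.code {σ : Type} {S : Signature σ} {vars : List σ} :
    {s : σ} → STerm S vars s → List (ℕ × ℕ)
  | _, .var i => [(0, (i : ℕ))]
  | _, .app f args => (1, (f : ℕ)) :: (List.ofFn fun j => (args j).code).flatten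

/-- The code of a pair of terms. -/
def TermPair.code {σ : Type} {S : Signature σ} {vars : List σ} (e : TermPair S vars) :
    List (ℕ × ℕ) × List (ℕ × ℕ) :=
  (e.lhs.code, e.rhs.code)

/-- The codes of systems: signature, sorts of the variables, equations, non-equalities. -/
abbrev SystemCode : Type :=
  List (List ℕ × ℕ) × List ℕ ×
    List (List (ℕ × ℕ) × List (ℕ × ℕ)) × List (List (ℕ × ℕ) × List (ℕ × ℕ))

/-- The code of a system, given a numbering `c` of the sorts. -/
def TermCodingSystem.code {σ : Type} (c : σ → ℕ) (Γ : TermCodingSystem σ) : SystemCode :=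
  (Γ.sig.map fun p => (p.1.map c, c p.2), Γ.vars.map c,
    Γ.equations.map TermPair.code, Γ.nonEqualities.map TermPair.code)

/-! ### The target of the translation -/

/-- The two sorts: the primary sort (the domain of the first-order structure) and `Bool`. -/
inductive TwoSort : Type
  | primary
  | bool

/-- The numbering of the two sorts. -/
def TwoSort.code : TwoSort → ℕ
  | .primary => 0
  | .bool => 1

/-- The characteristic symbols of a relational signature: for each relation symbol of arity `k`,
a function symbol from `k`-tuples of the primary sort to `Bool`. -/
def charSymbols (ar : List ℕ) : Signature TwoSort :=
  ar.map fun k => (List.replicate k TwoSort.primary, TwoSort.bool)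

/-- A translation `ψ ↦ Γ_ψ` of first-order sentences to systems is effective, uniformly in the
signature: one computable function maps the code of the signature and of `ψ` to the code
of `Γ_ψ`. -/
def IsEffective
    (Γ : (ar : List ℕ) → (relLang ar).Sentence → TermCodingSystem TwoSort) : Prop :=
  ∃ g : List ℕ × List (ℕ × List ℕ) → SystemCode, Computable g ∧
    ∀ (ar : List ℕ) (ψ : (relLang ar).Sentence),
      g (ar, formulaCode ψ) = (Γ ar ψ).code TwoSort.code

end TermCoding

/-!
The truth value of a formula is computed by a term of sort `Bool`, so that the system of a sentence
consists of the equation that sets the term of the sentence equal to true, the inequality of true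
and false, and equations that force the symbols in the terms to mean what they should.

Since `Bool` has only two elements, the truth table of the implication is given by closed
equations. For the equality, `eq(x, x) = true` is one half; the other half consists of
`select(true, x, y) = x` and `select(eq(x, y), x, y) = y`, which give `x = y` where `eq(x, y)` is
true.

A quantifier `∀ x_n φ` is removed with a witness function in the style of Hilbert: there are a
symbol `s` for the truth value of the scope `φ` and a symbol `w` for a counterexample to it, with
the equations `s(x) = (term of φ)` and `(s(x[x_n := w(x)]) → s(x[x_n := y])) = true`, where `y` is
a further variable; the term of `∀ x_n φ` is `s(x[x_n := w(x)])`. The symbols for the quantifiers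
take all of `x_0, …, x_{q-1}` as arguments, where `q` is the number of the quantifiers, which
bounds the depth of their nesting.

If the equations hold, the term of each formula has the right truth value (`value_formulaTerm`);
this turns a model of the system into a model of the sentence (`hasModelOfSize_of_isModel`).
Conversely, the scopes and the counterexamples in a model of the sentence can be chosen so that the
equations hold (`satisfies_formulaEquations`), which gives `isModel_standardModel`.

On codes, the translation is a right-to-left pass over the Polish notation of the sentence that
keeps the codes of the terms for the subformulas on a stack (`foldr_step`); it is primitive
recursive (`primrec_translateCode`).
-/

namespace TermCoding

/-! ### Terms and interpretations addressed by the entries of the signature -/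

section Symbols

variable {σ : Type}

/-- Tuples over a constant list of sorts are plain tuples. -/
def uniformArgs {α : σ → Type} {k : ℕ} {s : σ} :
    (Fin k → α s) ≃
      ((j : Fin (List.replicate k s).length) → α ((List.replicate k s).get j)) where
  toFun x j := cast (congrArg α (by simp)) (x (j.cast (by simp)))
  invFun y j := cast (congrArg α (by simp)) (y (j.cast (by simp)))
  left_inv x := by ext j; simp
  right_inv y := by ext j; simp

/-- A map between families of types commutes with the transport along an equality of sorts. -/
theorem apply_cast {α β : σ → Type} (f : ∀ s, α s → β s) {s t : σ} (h : s = t) (a : α s) :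
    f t (cast (congrArg α h) a) = cast (congrArg β h) (f s a) := by
  subst h; rfl

theorem apply_uniformArgs {α β : σ → Type} (f : ∀ s, α s → β s) {k : ℕ} {s : σ}
    (x : Fin k → α s) :
    (fun j => f _ (uniformArgs x j)) = uniformArgs fun j => f s (x j) := by
  funext j
  exact apply_cast f (by simp) _

/-- The list of the values that `f` takes on a tuple does not depend on how the tuple is indexed. -/
theorem ofFn_uniformArgs {α : σ → Type} {γ : Type} (f : ∀ s, α s → γ) {k : ℕ} {s : σ}
    (x : Fin k → α s) :
    (List.ofFn fun j => f _ (uniformArgs x j)) = List.ofFn fun j => f s (x j) := by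
  rw [List.ofFn_congr (List.length_replicate (n := k) (a := s))]
  congr 1
  funext j
  exact (apply_cast (β := fun _ => γ) f (by simp) _).trans (cast_eq _ _)

variable {S : Signature σ} {vars : List σ}

/-- A function in the family `C` of domains with the input sorts and the output sort `p`. -/
abbrev SortedMap (C : σ → Type) (p : List σ × σ) : Type :=
  ((j : Fin p.1.length) → C (p.1.get j)) → C p.2

theorem lt_of_lookup {β : Type} {l : List β} {i : ℕ} {b : β} (h : l[i]? = some b) :
    i < l.length :=
  (List.getElem?_eq_some_iff.1 h).1

theorem get_of_lookup {β : Type} {l : List β} {i : ℕ} {b : β} (h : l[i]? = some b) :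
    l.get ⟨i, lt_of_lookup h⟩ = b :=
  (List.getElem?_eq_some_iff.1 h).2

/-- The variable `x_i`, as a term of the sort listed for it. -/
def STerm.varAt {i : ℕ} {s : σ} (h : vars[i]? = some s) : STerm S vars s :=
  cast (congrArg (STerm S vars) (get_of_lookup h)) (.var ⟨i, lt_of_lookup h⟩)

/-- The application of the function symbol number `f`, with the sorts that the signature lists
for it. -/
def STerm.apply {f : ℕ} {p : List σ × σ} (h : S[f]? = some p)
    (args : (j : Fin p.1.length) → STerm S vars (p.1.get j)) : STerm S vars p.2 :=
  cast (congrArg (SortedMap (STerm S vars)) (get_of_lookup h)) (.app ⟨f, lt_of_lookup h⟩) args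

/-- The interpretation of the function symbol number `f`. -/
def Interpretation.fn (I : Interpretation S) {f : ℕ} {p : List σ × σ} (h : S[f]? = some p) :
    SortedMap I.carrier p :=
  cast (congrArg (SortedMap I.carrier) (get_of_lookup h)) (I.interp ⟨f, lt_of_lookup h⟩)

theorem STerm.code_varAt {i : ℕ} {s : σ} (h : vars[i]? = some s) :
    (STerm.varAt h : STerm S vars s).code = [(0, i)] := by
  obtain ⟨hi, rfl⟩ := List.getElem?_eq_some_iff.1 h
  rfl

theorem STerm.code_apply {f : ℕ} {p : List σ × σ} (h : S[f]? = some p)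
    (args : (j : Fin p.1.length) → STerm S vars (p.1.get j)) :
    (STerm.apply h args).code = (1, f) :: (List.ofFn fun j => (args j).code).flatten := by
  obtain ⟨hf, rfl⟩ := List.getElem?_eq_some_iff.1 h
  rfl

theorem STerm.eval_apply (I : Interpretation S)
    (a : (i : Fin vars.length) → I.carrier (vars.get i)) {f : ℕ} {p : List σ × σ}
    (h : S[f]? = some p) (args : (j : Fin p.1.length) → STerm S vars (p.1.get j)) :
    (STerm.apply h args).eval I a = I.fn h fun j => (args j).eval I a := by
  obtain ⟨hf, rfl⟩ := List.getElem?_eq_some_iff.1 h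
  rfl

/-- The application of a function symbol whose arguments all have the same sort. -/
def STerm.applyUniform {f k : ℕ} {s t : σ} (h : S[f]? = some (List.replicate k s, t))
    (args : Fin k → STerm S vars s) : STerm S vars t :=
  STerm.apply h (uniformArgs args)

/-- The interpretation of a function symbol whose arguments all have the same sort. -/
def Interpretation.fnUniform (I : Interpretation S) {f k : ℕ} {s t : σ}
    (h : S[f]? = some (List.replicate k s, t)) (x : Fin k → I.carrier s) : I.carrier t :=
  I.fn h (uniformArgs x)

theorem STerm.code_applyUniform {f k : ℕ} {s t : σ} (h : S[f]? = some (List.replicate k s, t))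
    (args : Fin k → STerm S vars s) :
    (STerm.applyUniform h args).code =
      (1, f) :: (List.ofFn fun j => (args j).code).flatten := by
  rw [STerm.applyUniform, STerm.code_apply]
  exact congrArg (fun l => (1, f) :: List.flatten l)
    (ofFn_uniformArgs (α := STerm S vars) (fun _ t => STerm.code t) args)

theorem STerm.eval_applyUniform (I : Interpretation S)
    (a : (i : Fin vars.length) → I.carrier (vars.get i)) {f k : ℕ} {s t : σ}
    (h : S[f]? = some (List.replicate k s, t)) (args : Fin k → STerm S vars s) :
    (STerm.applyUniform h args).eval I a = I.fnUniform h fun j => (args j).eval I a := by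
  rw [STerm.applyUniform, STerm.eval_apply]
  exact congrArg (I.fn h) (apply_uniformArgs (α := STerm S vars) (β := I.carrier)
    (fun _ t => STerm.eval I a t) args)

theorem STerm.eval_varAt {k : ℕ} {s : σ} (I : Interpretation S)
    (x : Fin k → I.carrier s) {i : ℕ} (h : (List.replicate k s)[i]? = some s) (hi : i < k) :
    (STerm.varAt h : STerm S (List.replicate k s) s).eval I (uniformArgs x) = x ⟨i, hi⟩ := by
  have key : ∀ {t : σ} (e : (List.replicate k s).get ⟨i, by simpa using hi⟩ = t),
      (cast (congrArg (STerm S (List.replicate k s)) e) (.var _)).eval I (uniformArgs x) =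
        cast (congrArg I.carrier e) (uniformArgs x ⟨i, by simpa using hi⟩) := by
    rintro _ rfl; rfl
  refine (key (by simp)).trans ?_
  simp [uniformArgs]

/-- The interpretation given by a list of functions that matches the signature. -/
def Interpretation.ofList (C : σ → Type) (hC : ∀ s, Finite (C s)) (hC' : ∀ s, Nonempty (C s))
    (L : List (Σ p, SortedMap C p)) (h : L.map Sigma.fst = S) : Interpretation S where
  carrier := C
  finite_carrier := hC
  nonempty_carrier := hC'
  interp f :=
    cast (congrArg (SortedMap C) (by simp [← h]))
      (L.get (f.cast (by simp [← h]))).2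

theorem Interpretation.fn_ofList (C : σ → Type) (hC : ∀ s, Finite (C s))
    (hC' : ∀ s, Nonempty (C s)) (L : List (Σ p, SortedMap C p))
    (h : L.map Sigma.fst = S) {f : ℕ} {p : List σ × σ} (F : SortedMap C p)
    (hF : L[f]? = some ⟨p, F⟩) (hf : S[f]? = some p) :
    (Interpretation.ofList C hC hC' L h).fn hf = F := by
  obtain ⟨hf', rfl⟩ := List.getElem?_eq_some_iff.1 hf
  obtain ⟨hF', e⟩ := List.getElem?_eq_some_iff.1 hF
  refine eq_of_heq (HEq.trans (cast_heq (α := SortedMap C _) _ _) ?_)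
  refine HEq.trans (cast_heq (α := SortedMap C (L.get ⟨f, hF'⟩).1) _ _) ?_
  exact (Sigma.ext_iff.1 e).2

end Symbols

/-! ### The system of a sentence -/

section Translation

/-- The scopes of the universal quantifiers of a formula, in the order in which the quantifiers
occur in its Polish notation read from right to left.  The position in this list is the number of
the quantifier. -/
def quantifiers {ar : List ℕ} :
    {n : ℕ} → (relLang ar).BoundedFormula Empty n →
      List (Σ n, (relLang ar).BoundedFormula Empty (n + 1))
  | _, .falsum => []
  | _, .equal _ _ => []
  | _, .rel _ _ => []
  | _, .imp φ₁ φ₂ => quantifiers φ₂ ++ quantifiers φ₁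
  | n, .all φ => quantifiers φ ++ [⟨n, φ⟩]

theorem varIndex_lt {ar : List ℕ} {n : ℕ} (t : (relLang ar).Term (Empty ⊕ Fin n)) :
    varIndex t < n := by
  match t with
  | .var (.inl e) => exact e.elim
  | .var (.inr i) => exact i.2
  | .func f _ => exact Empty.elim f

/-- The signature for the sentences with `q` quantifiers: after the characteristic symbols come
true, false, implication, equality, a selection function, and for each quantifier a symbol for
the truth value of its scope and a symbol for a counterexample to its scope. -/
def signature (ar : List ℕ) (q : ℕ) : Signature TwoSort :=
  charSymbols ar ++
    ([([], .bool), ([], .bool), ([.bool, .bool], .bool), ([.primary, .primary], .bool),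
      ([.bool, .primary, .primary], .primary)] ++
    (List.replicate q (List.replicate q .primary, .bool) ++
      List.replicate q (List.replicate q .primary, .primary)))

variable {ar : List ℕ} {q : ℕ}

theorem getElem?_signature_add (j : ℕ) :
    (signature ar q)[ar.length + j]? =
      ([([], .bool), ([], .bool), ([.bool, .bool], .bool), ([.primary, .primary], .bool),
        ([.bool, .primary, .primary], .primary)] ++
      (List.replicate q (List.replicate q TwoSort.primary, TwoSort.bool) ++
        List.replicate q (List.replicate q TwoSort.primary, TwoSort.primary)))[j]? := by
  rw [signature, List.getElem?_append_right (by simp [charSymbols])]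
  simp [charSymbols]

theorem lookup_rel (i : Fin ar.length) :
    (signature ar q)[(i : ℕ)]? =
      some (List.replicate (ar.get i) TwoSort.primary, TwoSort.bool) := by
  rw [signature, List.getElem?_append_left (by simp [charSymbols])]
  simp [charSymbols]

theorem lookup_true :
    (signature ar q)[ar.length + 0]? =
      some (List.replicate 0 TwoSort.primary, TwoSort.bool) := by
  rw [getElem?_signature_add]; rfl

theorem lookup_false :
    (signature ar q)[ar.length + 1]? =
      some (List.replicate 0 TwoSort.primary, TwoSort.bool) := by
  rw [getElem?_signature_add]; rfl

theorem lookup_imp :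
    (signature ar q)[ar.length + 2]? =
      some (List.replicate 2 TwoSort.bool, TwoSort.bool) := by
  rw [getElem?_signature_add]; rfl

theorem lookup_eq :
    (signature ar q)[ar.length + 3]? =
      some (List.replicate 2 TwoSort.primary, TwoSort.bool) := by
  rw [getElem?_signature_add]; rfl

theorem lookup_select :
    (signature ar q)[ar.length + 4]? =
      some ([TwoSort.bool, TwoSort.primary, TwoSort.primary], TwoSort.primary) := by
  rw [getElem?_signature_add]; rfl

theorem lookup_scope {k : ℕ} (hk : k < q) :
    (signature ar q)[ar.length + (5 + k)]? =
      some (List.replicate q TwoSort.primary, TwoSort.bool) := by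
  rw [getElem?_signature_add, List.getElem?_append_right (by simp),
    List.getElem?_append_left (by simpa using hk)]
  simp [hk]

theorem lookup_witness {k : ℕ} (hk : k < q) :
    (signature ar q)[ar.length + (5 + (q + k))]? =
      some (List.replicate q TwoSort.primary, TwoSort.primary) := by
  rw [getElem?_signature_add, List.getElem?_append_right (by simp),
    List.getElem?_append_right (by simp)]
  simp [hk]

variable (ar q) in
/-- The terms over the signature for `q` quantifiers.  There are `q + 2` variables, all of the
primary sort: `x_0, …, x_{q-1}` play the quantified variables, and `x_q` is not among them. The
equations for the equality need `x_0` and `x_1` even if `q = 0`. -/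
abbrev Tm (s : TwoSort) : Type :=
  STerm (signature ar q) (List.replicate (q + 2) .primary) s

/-- The variable `x_i`. -/
def varTerm (i : ℕ) (h : i < q + 2) : Tm ar q .primary :=
  .varAt (i := i) (by simp [h])

/-- The constant true. -/
def trueTerm : Tm ar q .bool := .applyUniform lookup_true finZeroElim

/-- The constant false. -/
def falseTerm : Tm ar q .bool := .applyUniform lookup_false finZeroElim

/-- The implication between two truth values. -/
def impTerm (a b : Tm ar q .bool) : Tm ar q .bool := .applyUniform lookup_imp ![a, b]

/-- The truth value of the equality of two elements. -/
def eqTerm (a b : Tm ar q .primary) : Tm ar q .bool := .applyUniform lookup_eq ![a, b]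

/-- The triple `(c, a, b)`, as a tuple over the input sorts of the selection function. -/
def selectArgs {α : TwoSort → Type} (c : α .bool) (a b : α .primary) :
    (j : Fin [TwoSort.bool, TwoSort.primary, TwoSort.primary].length) →
      α ([TwoSort.bool, TwoSort.primary, TwoSort.primary].get j)
  | ⟨0, _⟩ => c
  | ⟨1, _⟩ => a
  | ⟨2, _⟩ => b

/-- If `c` then `a` else `b`. -/
def selectTerm (c : Tm ar q .bool) (a b : Tm ar q .primary) : Tm ar q .primary :=
  .apply lookup_select (selectArgs c a b)

/-- The truth value of the atomic formula with the `i`-th relation symbol. -/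
def relTerm (i : Fin ar.length) (args : Fin (ar.get i) → Tm ar q .primary) : Tm ar q .bool :=
  .applyUniform (lookup_rel i) args

/-- The truth value of the scope of the `k`-th quantifier. -/
def scopeTerm (k : ℕ) (hk : k < q) (args : Fin q → Tm ar q .primary) : Tm ar q .bool :=
  .applyUniform (lookup_scope hk) args

/-- The truth value of the scope of the `k`-th quantifier, at `(x_0, …, x_{q-1})` with `u` in the
place of `x_n`. -/
def instanceTerm (k : ℕ) (hk : k < q) (n : ℕ) (u : Tm ar q .primary) : Tm ar q .bool :=
  scopeTerm k hk fun i => if (i : ℕ) = n then u else varTerm i (by omega)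

/-- A counterexample to the scope of the `k`-th quantifier, if there is one. -/
def witnessTerm (k : ℕ) (hk : k < q) : Tm ar q .primary :=
  .applyUniform (lookup_witness hk) fun i : Fin q => varTerm i (by omega)

/-- The truth value of a formula at `(x_0, …, x_{n-1})`, where `k` is the number of the first of its
quantifiers. A universal statement has the truth value of its instance at the chosen
counterexample. -/
def formulaTerm : {n : ℕ} → (φ : (relLang ar).BoundedFormula Empty n) → (k : ℕ) →
    n + (quantifiers φ).length ≤ q → k + (quantifiers φ).length ≤ q → Tm ar q .bool
  | _, .falsum, _, _, _ => falseTerm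
  | _, .equal t₁ t₂, _, h, _ =>
    eqTerm (varTerm (varIndex t₁) (by have := varIndex_lt t₁; omega))
      (varTerm (varIndex t₂) (by have := varIndex_lt t₂; omega))
  | _, .rel R ts, _, h, _ =>
    relTerm R.1 fun j => varTerm (varIndex (ts (j.cast R.2)))
      (by have := varIndex_lt (ts (j.cast R.2)); omega)
  | _, .imp φ₁ φ₂, k, h, h' =>
    impTerm
      (formulaTerm φ₁ (k + (quantifiers φ₂).length)
        (by simp only [quantifiers, List.length_append] at h; omega)
        (by simp only [quantifiers, List.length_append] at h'; omega))
      (formulaTerm φ₂ k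
        (by simp only [quantifiers, List.length_append] at h; omega)
        (by simp only [quantifiers, List.length_append] at h'; omega))
  | n, .all φ, k, _, h' =>
    have hk : k + (quantifiers φ).length < q := by
      simp only [quantifiers, List.length_append, List.length_singleton] at h'; omega
    instanceTerm _ hk n (witnessTerm _ hk)

/-- The equations for the quantifiers of a formula: the symbol for the truth value of the scope
means what it should, and if the scope holds at the chosen counterexample then it holds
everywhere. -/
def formulaEquations : {n : ℕ} → (φ : (relLang ar).BoundedFormula Empty n) → (k : ℕ) →
    n + (quantifiers φ).length ≤ q → k + (quantifiers φ).length ≤ q →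
    List (TermPair (signature ar q) (List.replicate (q + 2) .primary))
  | _, .falsum, _, _, _ => []
  | _, .equal _ _, _, _, _ => []
  | _, .rel _ _, _, _, _ => []
  | _, .imp φ₁ φ₂, k, h, h' =>
    formulaEquations φ₁ (k + (quantifiers φ₂).length)
        (by simp only [quantifiers, List.length_append] at h; omega)
        (by simp only [quantifiers, List.length_append] at h'; omega) ++
      formulaEquations φ₂ k
        (by simp only [quantifiers, List.length_append] at h; omega)
        (by simp only [quantifiers, List.length_append] at h'; omega)
  | n, .all φ, k, h, h' =>
    have hk : k + (quantifiers φ).length < q := by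
      simp only [quantifiers, List.length_append, List.length_singleton] at h'; omega
    have hn : n + 1 + (quantifiers φ).length ≤ q := by
      simp only [quantifiers, List.length_append, List.length_singleton] at h; omega
    ⟨.bool, scopeTerm _ hk fun i => varTerm i (by omega), formulaTerm φ k hn hk.le⟩ ::
      ⟨.bool, impTerm (instanceTerm _ hk n (witnessTerm _ hk))
        (instanceTerm _ hk n (varTerm q (by omega))), trueTerm⟩ ::
      formulaEquations φ k hn hk.le

/-- The equations for the truth values, the equality and the selection function. The last two force
`x_0 = x_1` wherever the truth value of `x_0 = x_1` is true. -/
def logicEquations : List (TermPair (signature ar q) (List.replicate (q + 2) .primary)) :=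
  [⟨.bool, impTerm trueTerm trueTerm, trueTerm⟩,
    ⟨.bool, impTerm trueTerm falseTerm, falseTerm⟩,
    ⟨.bool, impTerm falseTerm trueTerm, trueTerm⟩,
    ⟨.bool, impTerm falseTerm falseTerm, trueTerm⟩,
    ⟨.bool, eqTerm (varTerm 0 (by omega)) (varTerm 0 (by omega)), trueTerm⟩,
    ⟨.primary, selectTerm trueTerm (varTerm 0 (by omega)) (varTerm 1 (by omega)),
      varTerm 0 (by omega)⟩,
    ⟨.primary, selectTerm (eqTerm (varTerm 0 (by omega)) (varTerm 1 (by omega)))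
      (varTerm 0 (by omega)) (varTerm 1 (by omega)), varTerm 1 (by omega)⟩]

/-- The system of a sentence: its truth value is true. -/
def translate (ar : List ℕ) (ψ : (relLang ar).Sentence) : TermCodingSystem TwoSort where
  sig := signature ar (quantifiers ψ).length
  vars := List.replicate ((quantifiers ψ).length + 2) .primary
  equations := ⟨.bool, formulaTerm ψ 0 (by omega) (by omega), trueTerm⟩ ::
    (logicEquations ++ formulaEquations ψ 0 (by omega) (by omega))
  nonEqualities := [⟨.bool, trueTerm, falseTerm⟩]

end Translation

/-! ### The codes of the terms -/

section Codes

variable {ar : List ℕ} {q : ℕ}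

theorem code_varTerm (i : ℕ) (h : i < q + 2) : (varTerm i h : Tm ar q .primary).code = [(0, i)] :=
  STerm.code_varAt _

theorem code_trueTerm : (trueTerm : Tm ar q .bool).code = [(1, ar.length)] := by
  simp [trueTerm, STerm.code_applyUniform]

theorem code_falseTerm : (falseTerm : Tm ar q .bool).code = [(1, ar.length + 1)] := by
  simp [falseTerm, STerm.code_applyUniform]

theorem code_impTerm (a b : Tm ar q .bool) :
    (impTerm a b).code = (1, ar.length + 2) :: (a.code ++ b.code) := by
  simp [impTerm, STerm.code_applyUniform]

theorem code_eqTerm (a b : Tm ar q .primary) :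
    (eqTerm a b).code = (1, ar.length + 3) :: (a.code ++ b.code) := by
  simp [eqTerm, STerm.code_applyUniform]

theorem code_selectTerm (c : Tm ar q .bool) (a b : Tm ar q .primary) :
    (selectTerm c a b).code = (1, ar.length + 4) :: (c.code ++ (a.code ++ b.code)) := by
  rw [selectTerm, STerm.code_apply]
  simp [List.ofFn_succ, selectArgs]

theorem code_relTerm (i : Fin ar.length) (args : Fin (ar.get i) → ℕ)
    (h : ∀ j, args j < q + 2) :
    (relTerm i fun j => varTerm (args j) (h j) : Tm ar q .bool).code =
      (1, (i : ℕ)) :: (List.ofFn args).map fun v => (0, v) := by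
  simp only [relTerm, STerm.code_applyUniform, code_varTerm, List.map_ofFn]
  congr 1
  have e := List.flatMap_singleton' (List.ofFn fun j => (0, args j))
  rwa [List.flatMap, List.map_ofFn] at e

/-- The code of `witnessTerm k`. -/
def witnessCode (m q k : ℕ) : List (ℕ × ℕ) :=
  (1, m + (5 + (q + k))) :: (List.range q).map fun i => (0, i)

/-- The code of `instanceTerm k n u`, where `u` has the code `c`. -/
def instanceCode (m q k n : ℕ) (c : List (ℕ × ℕ)) : List (ℕ × ℕ) :=
  (1, m + (5 + k)) :: (List.range q).flatMap fun i => if i = n then c else [(0, i)]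

theorem ofFn_flatten_eq_range_flatMap {β : Type} (f : ℕ → List β) (k : ℕ) :
    (List.ofFn fun i : Fin k => f i).flatten = (List.range k).flatMap f := by
  rw [List.flatMap, List.ofFn_eq_map, ← List.map_coe_finRange_eq_range, List.map_map]
  rfl

theorem code_witnessTerm (k : ℕ) (hk : k < q) :
    (witnessTerm k hk : Tm ar q .primary).code = witnessCode ar.length q k := by
  simp only [witnessTerm, STerm.code_applyUniform, code_varTerm, witnessCode]
  rw [ofFn_flatten_eq_range_flatMap (fun i => [(0, i)])]
  rw [List.map_eq_flatMap]

theorem code_instanceTerm (k : ℕ) (hk : k < q) (n : ℕ) (u : Tm ar q .primary) :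
    (instanceTerm k hk n u).code = instanceCode ar.length q k n u.code := by
  simp only [instanceTerm, scopeTerm, STerm.code_applyUniform, instanceCode,
    ← ofFn_flatten_eq_range_flatMap]
  congr 4
  funext i
  split <;> simp [code_varTerm]

theorem code_scopeTerm (k : ℕ) (hk : k < q) :
    (scopeTerm k hk fun i => varTerm i (by omega) : Tm ar q .bool).code =
      instanceCode ar.length q k q [] := by
  simp only [scopeTerm, STerm.code_applyUniform, instanceCode,
    ← ofFn_flatten_eq_range_flatMap]
  congr 4
  funext i
  rw [if_neg i.2.ne, code_varTerm]

end Codes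

/-! ### The translation on codes -/

section Fold

/-- The state of a right-to-left pass over the Polish notation of a formula: the number of the
quantifiers seen so far, the stack of the codes of the terms for the maximal subformulas seen so
far, and the codes of the equations for the quantifiers. -/
abbrev PassState : Type :=
  ℕ × List (List (ℕ × ℕ)) × List (List (ℕ × ℕ) × List (ℕ × ℕ))

/-- What a token that is not a quantifier does to the stack: `m` is the number of the relation
symbols. -/
def stepStack (m : ℕ) (t : ℕ × List ℕ) (st : List (List (ℕ × ℕ))) : List (List (ℕ × ℕ)) :=
  if t.1 = 0 then [(1, m + 1)] :: st
  else if t.1 = 1 then ((1, m + 3) :: t.2.map fun v => (0, v)) :: st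
  else if t.1 = 2 then ((1, t.2.headI) :: t.2.tail.map fun v => (0, v)) :: st
  else ((1, m + 2) :: (st.headI ++ st.tail.headI)) :: st.tail.tail

/-- What the quantifier `∀ x_n` does: its scope is on the top of the stack. -/
def stepAll (m q n : ℕ) (s : PassState) : PassState :=
  (s.1 + 1, instanceCode m q s.1 n (witnessCode m q s.1) :: s.2.1.tail,
    -- There is no argument number `q`, so that nothing is replaced in the first code.
    (instanceCode m q s.1 q [], s.2.1.headI) ::
    ((1, m + 2) :: (instanceCode m q s.1 n (witnessCode m q s.1) ++
      instanceCode m q s.1 n [(0, q)]), [(1, m)]) :: s.2.2)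

/-- One step of the pass, with `m` relation symbols and `q` quantifiers in the whole sentence. -/
def step (m q : ℕ) (t : ℕ × List ℕ) (s : PassState) : PassState :=
  if t.1 = 4 then stepAll m q t.2.headI s else (s.1, stepStack m t s.2.1, s.2.2)

/-- The number of the quantifiers, from the code of a formula. -/
def countQuantifiers (l : List (ℕ × List ℕ)) : ℕ :=
  l.foldr (fun t k => if t.1 = 4 then k + 1 else k) 0

theorem foldr_count {ar : List ℕ} {n : ℕ} (φ : (relLang ar).BoundedFormula Empty n) (k : ℕ) :
    (formulaCode φ).foldr (fun t k => if t.1 = 4 then k + 1 else k) k =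
      k + (quantifiers φ).length := by
  induction φ generalizing k with
  | falsum => simp [formulaCode, quantifiers]
  | equal => simp [formulaCode, quantifiers]
  | rel => simp [formulaCode, quantifiers]
  | imp φ₁ φ₂ ih₁ ih₂ => simp [formulaCode, quantifiers, ih₁, ih₂, Nat.add_assoc]
  | all φ ih => simp [formulaCode, quantifiers, ih, Nat.add_assoc]

/-- The pass over the code of a formula pushes the code of its term on the stack, and puts the codes
of its equations before those already there. -/
theorem foldr_step {ar : List ℕ} {q n : ℕ} (φ : (relLang ar).BoundedFormula Empty n)
    (s : PassState) (h : n + (quantifiers φ).length ≤ q)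
    (h' : s.1 + (quantifiers φ).length ≤ q) :
    (formulaCode φ).foldr (step ar.length q) s =
      (s.1 + (quantifiers φ).length, (formulaTerm φ s.1 h h').code :: s.2.1,
        (formulaEquations φ s.1 h h').map TermPair.code ++ s.2.2) := by
  induction φ generalizing s with
  | falsum =>
    simp [formulaCode, quantifiers, formulaTerm, formulaEquations, step, stepStack, code_falseTerm]
  | equal =>
    simp [formulaCode, quantifiers, formulaTerm, formulaEquations, step, stepStack, code_eqTerm,
      code_varTerm]
  | @rel n l R ts =>
    obtain ⟨i, rfl⟩ := R
    simp only [formulaCode, quantifiers, formulaTerm, formulaEquations, List.foldr_cons,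
      List.foldr_nil, step, stepStack, code_relTerm]
    simp
  | imp φ₁ φ₂ ih₁ ih₂ =>
    have e : (quantifiers (φ₁.imp φ₂)).length =
        (quantifiers φ₂).length + (quantifiers φ₁).length := by simp [quantifiers]
    rw [formulaCode, List.foldr_cons, List.foldr_append, ih₂ s (by omega) (by omega),
      ih₁ _ (by omega) (by simp only; omega)]
    simp [quantifiers, formulaTerm, formulaEquations, step, stepStack, code_impTerm,
      Nat.add_assoc]
  | all φ ih =>
    have e : (quantifiers φ.all).length = (quantifiers φ).length + 1 := by simp [quantifiers]
    rw [formulaCode, List.foldr_cons, ih s (by omega) (by omega)]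
    simp [quantifiers, formulaTerm, formulaEquations, step, stepAll, code_impTerm,
      code_instanceTerm, code_witnessTerm, code_scopeTerm, code_varTerm, code_trueTerm,
      TermPair.code, Nat.add_assoc]

/-- The code of `signature ar q`; the constant lists are written as images of ranges. -/
def signatureCode (ar : List ℕ) (q : ℕ) : List (List ℕ × ℕ) :=
  ar.map (fun k => ((List.range k).map fun _ => 0, 1)) ++
    ([([], 1), ([], 1), ([1, 1], 1), ([0, 0], 1), ([1, 0, 0], 0)] ++
      (((List.range q).map fun _ => ((List.range q).map fun _ => 0, 1)) ++
        (List.range q).map fun _ => ((List.range q).map fun _ => 0, 0)))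

/-- The codes of the equations of `logicEquations`, for the empty relational signature. -/
def logicTable : List (List (ℕ × ℕ) × List (ℕ × ℕ)) :=
  [([(1, 2), (1, 0), (1, 0)], [(1, 0)]),
    ([(1, 2), (1, 0), (1, 1)], [(1, 1)]),
    ([(1, 2), (1, 1), (1, 0)], [(1, 0)]),
    ([(1, 2), (1, 1), (1, 1)], [(1, 0)]),
    ([(1, 3), (0, 0), (0, 0)], [(1, 0)]),
    ([(1, 4), (1, 0), (0, 0), (0, 1)], [(0, 0)]),
    ([(1, 4), (1, 3), (0, 0), (0, 1), (0, 0), (0, 1)], [(0, 1)])]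

/-- The renumbering of the function symbols of a term that makes room for `m` symbols. -/
def shiftSymbols (m : ℕ) (c : List (ℕ × ℕ)) : List (ℕ × ℕ) :=
  c.map fun t => (t.1, m * t.1 + t.2)

/-- The translation on codes. -/
def translateCode (p : List ℕ × List (ℕ × List ℕ)) : SystemCode :=
  let q := countQuantifiers p.2
  let s := p.2.foldr (step p.1.length q) (0, [], [])
  (signatureCode p.1 q, (List.range (q + 2)).map fun _ => 0,
    (s.2.1.headI, [(1, p.1.length)]) ::
      (logicTable.map (fun e => (shiftSymbols p.1.length e.1, shiftSymbols p.1.length e.2)) ++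
        s.2.2),
    [([(1, p.1.length)], [(1, p.1.length + 1)])])

theorem map_code_logicEquations {ar : List ℕ} {q : ℕ} :
    (logicEquations (ar := ar) (q := q)).map TermPair.code =
      logicTable.map fun e => (shiftSymbols ar.length e.1, shiftSymbols ar.length e.2) := by
  simp [logicEquations, logicTable, shiftSymbols, TermPair.code, code_impTerm, code_trueTerm,
    code_falseTerm, code_eqTerm, code_selectTerm, code_varTerm]

theorem translateCode_eq (ar : List ℕ) (ψ : (relLang ar).Sentence) :
    translateCode (ar, formulaCode ψ) = (translate ar ψ).code TwoSort.code := by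
  have hq : countQuantifiers (formulaCode ψ) = (quantifiers ψ).length :=
    (foldr_count ψ 0).trans (Nat.zero_add _)
  rw [translateCode]
  simp only [hq]
  rw [foldr_step ψ (0, [], []) (by omega) (by simp)]
  have htrue := code_trueTerm (ar := ar) (q := (quantifiers ψ).length)
  have hfalse := code_falseTerm (ar := ar) (q := (quantifiers ψ).length)
  simp only [TermCodingSystem.code, translate, TermPair.code, signatureCode, signature,
    charSymbols, TwoSort.code, Function.comp_def, List.map_const', List.length_range,
    List.map_append, List.map_map, List.map_replicate, List.map_cons, List.map_nil,
    List.headI_cons, List.append_nil, Prod.mk.injEq, List.cons.injEq, true_and, and_true]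
  exact ⟨⟨htrue.symm, (congrArg (· ++ _) map_code_logicEquations).symm.trans
    List.map_append.symm⟩, htrue.symm, hfalse.symm⟩

end Fold

/-! ### Computability of the translation -/

section Computability

open Primrec

variable {α : Type} [Primcodable α]

theorem primrec_map_const {β γ : Type} [Primcodable β] [Primcodable γ] {f : α → List β}
    (hf : Primrec f) (c : γ) : Primrec fun a => (f a).map fun _ => c :=
  list_map hf (Primrec.const c).to₂

theorem primrec_map_var {f : α → List ℕ} (hf : Primrec f) :
    Primrec fun a => (f a).map fun v => ((0, v) : ℕ × ℕ) :=
  list_map hf (pair (Primrec.const 0) snd).to₂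

theorem primrec_instanceCode {m q k n : α → ℕ} {c : α → List (ℕ × ℕ)} (hm : Primrec m)
    (hq : Primrec q) (hk : Primrec k) (hn : Primrec n) (hc : Primrec c) :
    Primrec fun a => instanceCode (m a) (q a) (k a) (n a) (c a) := by
  refine list_cons.comp (pair (Primrec.const 1)
    (nat_add.comp hm (nat_add.comp (Primrec.const 5) hk))) ?_
  refine list_flatMap (list_range.comp hq) ?_
  exact Primrec.ite (Primrec.eq.comp snd (hn.comp fst)) (hc.comp fst)
    (list_cons.comp (pair (Primrec.const 0) snd) (Primrec.const []))

theorem primrec_witnessCode {m q k : α → ℕ} (hm : Primrec m) (hq : Primrec q) (hk : Primrec k) :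
    Primrec fun a => witnessCode (m a) (q a) (k a) :=
  list_cons.comp (pair (Primrec.const 1)
    (nat_add.comp hm (nat_add.comp (Primrec.const 5) (nat_add.comp hq hk))))
    (primrec_map_var (list_range.comp hq))

theorem primrec_stepStack {m : α → ℕ} {t : α → ℕ × List ℕ} {st : α → List (List (ℕ × ℕ))}
    (hm : Primrec m) (ht : Primrec t) (hst : Primrec st) :
    Primrec fun a => stepStack (m a) (t a) (st a) := by
  have tag (i : ℕ) : PrimrecPred fun a => (t a).1 = i :=
    Primrec.eq.comp (fst.comp ht) (Primrec.const i)
  have symbol (i : ℕ) : Primrec fun a => ((1, m a + i) : ℕ × ℕ) :=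
    pair (Primrec.const 1) (nat_add.comp hm (Primrec.const i))
  have ht' := snd.comp ht
  have htail := list_tail.comp hst
  refine Primrec.ite (tag 0) (list_cons.comp (list_cons.comp (symbol 1) (Primrec.const [])) hst) ?_
  refine Primrec.ite (tag 1)
    (list_cons.comp (list_cons.comp (symbol 3) (primrec_map_var ht')) hst) ?_
  refine Primrec.ite (tag 2)
    (list_cons.comp (list_cons.comp (pair (Primrec.const 1) (list_headI.comp ht'))
      (primrec_map_var (list_tail.comp ht'))) hst) ?_
  exact list_cons.comp (list_cons.comp (symbol 2)
    (list_append.comp (list_headI.comp hst) (list_headI.comp htail))) (list_tail.comp htail)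

theorem primrec_stepAll {m q n : α → ℕ} {s : α → PassState} (hm : Primrec m) (hq : Primrec q)
    (hn : Primrec n) (hs : Primrec s) :
    Primrec fun a => stepAll (m a) (q a) (n a) (s a) := by
  have hk := fst.comp hs
  have hst := fst.comp (snd.comp hs)
  have hi := primrec_instanceCode hm hq hk hn (primrec_witnessCode hm hq hk)
  have hy := primrec_instanceCode hm hq hk hn
    (list_cons.comp (pair (Primrec.const 0) hq) (Primrec.const []))
  refine pair (succ.comp hk) (pair (list_cons.comp hi (list_tail.comp hst)) ?_)
  refine list_cons.comp (pair (primrec_instanceCode hm hq hk hq (Primrec.const []))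
    (list_headI.comp hst)) (list_cons.comp (pair ?_ ?_) (snd.comp (snd.comp hs)))
  · exact list_cons.comp (pair (Primrec.const 1) (nat_add.comp hm (Primrec.const 2)))
      (list_append.comp hi hy)
  · exact list_cons.comp (pair (Primrec.const 1) hm) (Primrec.const [])

theorem primrec_step {m q : α → ℕ} {t : α → ℕ × List ℕ} {s : α → PassState} (hm : Primrec m)
    (hq : Primrec q) (ht : Primrec t) (hs : Primrec s) :
    Primrec fun a => step (m a) (q a) (t a) (s a) :=
  Primrec.ite (Primrec.eq.comp (fst.comp ht) (Primrec.const 4))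
    (primrec_stepAll hm hq (list_headI.comp (snd.comp ht)) hs)
    (pair (fst.comp hs) (pair (primrec_stepStack hm ht (fst.comp (snd.comp hs)))
      (snd.comp (snd.comp hs))))

theorem primrec_countQuantifiers : Primrec countQuantifiers :=
  list_foldr (h := fun _ (p : (ℕ × List ℕ) × ℕ) => if p.1.1 = 4 then p.2 + 1 else p.2)
    Primrec.id (Primrec.const 0)
    (Primrec.ite (Primrec.eq.comp (fst.comp (fst.comp snd)) (Primrec.const 4))
      (succ.comp (snd.comp snd)) (snd.comp snd)).to₂

theorem primrec_shiftSymbols {m : α → ℕ} {c : α → List (ℕ × ℕ)} (hm : Primrec m)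
    (hc : Primrec c) : Primrec fun a => shiftSymbols (m a) (c a) :=
  list_map hc (pair (fst.comp snd)
    (nat_add.comp (nat_mul.comp (hm.comp fst) (fst.comp snd)) (snd.comp snd))).to₂

theorem primrec_signatureCode {ar : α → List ℕ} {q : α → ℕ} (har : Primrec ar) (hq : Primrec q) :
    Primrec fun a => signatureCode (ar a) (q a) := by
  have hr : Primrec fun a => (List.range (q a)).map fun _ => 0 :=
    primrec_map_const (list_range.comp hq) 0
  refine list_append.comp (list_map har ?_) (list_append.comp (Primrec.const _)
    (list_append.comp (list_map (list_range.comp hq) ?_) (list_map (list_range.comp hq) ?_)))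
  · exact pair (primrec_map_const (list_range.comp snd) 0) (Primrec.const 1)
  · exact pair (hr.comp fst) (Primrec.const 1)
  · exact pair (hr.comp fst) (Primrec.const 0)

theorem primrec_translateCode : Primrec translateCode := by
  have hq : Primrec fun p : List ℕ × List (ℕ × List ℕ) => countQuantifiers p.2 :=
    primrec_countQuantifiers.comp snd
  have hm : Primrec fun p : List ℕ × List (ℕ × List ℕ) => p.1.length := list_length.comp fst
  have hs : Primrec fun p : List ℕ × List (ℕ × List ℕ) =>
      p.2.foldr (step p.1.length (countQuantifiers p.2)) (0, [], []) :=
    list_foldr (h := fun p x => step p.1.length (countQuantifiers p.2) x.1 x.2) snd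
      (Primrec.const (0, [], []))
      (primrec_step (hm.comp fst) (hq.comp fst) (fst.comp snd) (snd.comp snd))
  have htrue : Primrec fun p : List ℕ × List (ℕ × List ℕ) => [((1, p.1.length) : ℕ × ℕ)] :=
    list_cons.comp (pair (Primrec.const 1) hm) (Primrec.const [])
  have hfalse : Primrec fun p : List ℕ × List (ℕ × List ℕ) => [((1, p.1.length + 1) : ℕ × ℕ)] :=
    list_cons.comp (pair (Primrec.const 1) (succ.comp hm)) (Primrec.const [])
  have htable : Primrec fun p : List ℕ × List (ℕ × List ℕ) => logicTable.map
      fun e => (shiftSymbols p.1.length e.1, shiftSymbols p.1.length e.2) :=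
    list_map (Primrec.const logicTable)
      (pair (primrec_shiftSymbols (hm.comp fst) (fst.comp snd))
        (primrec_shiftSymbols (hm.comp fst) (snd.comp snd)))
  refine pair (primrec_signatureCode fst hq) (pair ?_ (pair ?_ ?_))
  · exact primrec_map_const (list_range.comp (nat_add.comp hq (Primrec.const 2))) 0
  · exact list_cons.comp (pair (list_headI.comp (fst.comp (snd.comp hs))) htrue)
      (list_append.comp htable (snd.comp (snd.comp hs)))
  · exact list_cons.comp (pair htrue hfalse) (Primrec.const [])

theorem isEffective_translate : IsEffective translate :=
  ⟨translateCode, primrec_translateCode.to_comp, translateCode_eq⟩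

end Computability

/-! ### The truth values of the terms for the formulas -/

section Semantics

open FirstOrder.Language

variable {ar : List ℕ} {q : ℕ} (I : Interpretation (signature ar q))

/-- The value of a term, where `x_i` has the value `e i`. -/
def value (e : ℕ → I.carrier .primary) {s : TwoSort} (t : Tm ar q s) : I.carrier s :=
  t.eval I (uniformArgs fun i : Fin (q + 2) => e i)

/-- The value of the constant true. -/
def trueVal : I.carrier .bool := I.fnUniform lookup_true finZeroElim

/-- The value of the constant false. -/
def falseVal : I.carrier .bool := I.fnUniform lookup_false finZeroElim

/-- The interpretation of the implication. -/
def impVal (a b : I.carrier .bool) : I.carrier .bool := I.fnUniform lookup_imp ![a, b]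

/-- The interpretation of the equality. -/
def eqVal (a b : I.carrier .primary) : I.carrier .bool := I.fnUniform lookup_eq ![a, b]

/-- The interpretation of the selection function. -/
def selectVal (c : I.carrier .bool) (a b : I.carrier .primary) : I.carrier .primary :=
  I.fn lookup_select (selectArgs c a b)

/-- The interpretation of a characteristic symbol. -/
def relVal (i : Fin ar.length) (x : Fin (ar.get i) → I.carrier .primary) : I.carrier .bool :=
  I.fnUniform (lookup_rel i) x

/-- The interpretation of the symbol for the truth value of the scope of a quantifier. -/
def scopeVal (k : ℕ) (hk : k < q) (x : Fin q → I.carrier .primary) : I.carrier .bool :=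
  I.fnUniform (lookup_scope hk) x

/-- The interpretation of the symbol for a counterexample to the scope of a quantifier. -/
def witnessVal (k : ℕ) (hk : k < q) (x : Fin q → I.carrier .primary) : I.carrier .primary :=
  I.fnUniform (lookup_witness hk) x

variable {I} (e : ℕ → I.carrier .primary)

theorem value_varTerm (i : ℕ) (h : i < q + 2) : value I e (varTerm i h) = e i :=
  STerm.eval_varAt I _ _ h

theorem value_trueTerm : value I e trueTerm = trueVal I :=
  (STerm.eval_applyUniform I _ _ _).trans
    (congrArg (I.fnUniform lookup_true) (Subsingleton.elim _ _))

theorem value_falseTerm : value I e falseTerm = falseVal I :=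
  (STerm.eval_applyUniform I _ _ _).trans
    (congrArg (I.fnUniform lookup_false) (Subsingleton.elim _ _))

theorem value_impTerm (a b : Tm ar q .bool) :
    value I e (impTerm a b) = impVal I (value I e a) (value I e b) := by
  refine (STerm.eval_applyUniform I _ _ _).trans (congrArg (I.fnUniform lookup_imp) ?_)
  ext j
  fin_cases j <;> rfl

theorem value_eqTerm (a b : Tm ar q .primary) :
    value I e (eqTerm a b) = eqVal I (value I e a) (value I e b) := by
  refine (STerm.eval_applyUniform I _ _ _).trans (congrArg (I.fnUniform lookup_eq) ?_)
  ext j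
  fin_cases j <;> rfl

theorem value_selectTerm (c : Tm ar q .bool) (a b : Tm ar q .primary) :
    value I e (selectTerm c a b) = selectVal I (value I e c) (value I e a) (value I e b) := by
  refine (STerm.eval_apply I _ _ _).trans (congrArg (I.fn lookup_select) ?_)
  ext j
  match j with
  | ⟨0, _⟩ => rfl
  | ⟨1, _⟩ => rfl
  | ⟨2, _⟩ => rfl

theorem value_relTerm (i : Fin ar.length) (args : Fin (ar.get i) → Tm ar q .primary) :
    value I e (relTerm i args) = relVal I i fun j => value I e (args j) :=
  STerm.eval_applyUniform I _ _ _

theorem value_scopeTerm (k : ℕ) (hk : k < q) :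
    value I e (scopeTerm k hk fun i => varTerm i (by omega)) = scopeVal I k hk fun i => e i :=
  (STerm.eval_applyUniform I _ _ _).trans
    (congrArg (I.fnUniform (lookup_scope hk)) (funext fun _ => value_varTerm e _ _))

theorem value_witnessTerm (k : ℕ) (hk : k < q) :
    value I e (witnessTerm k hk) = witnessVal I k hk fun i => e i :=
  (STerm.eval_applyUniform I _ _ _).trans
    (congrArg (I.fnUniform (lookup_witness hk)) (funext fun _ => value_varTerm e _ _))

theorem value_instanceTerm (k : ℕ) (hk : k < q) (n : ℕ) (u : Tm ar q .primary) :
    value I e (instanceTerm k hk n u) =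
      scopeVal I k hk fun i => Function.update e n (value I e u) i := by
  refine (STerm.eval_applyUniform I _ _ _).trans
    (congrArg (I.fnUniform (lookup_scope hk)) (funext fun i => ?_))
  by_cases hi : (i : ℕ) = n
  · simp only [hi, Function.update_self, if_true]
    rfl
  · simp only [hi, Function.update_of_ne hi, if_false]
    exact value_varTerm e _ _

/-- The `i`-th relation symbol. -/
def relSymbol {ar : List ℕ} (i : Fin ar.length) : (relLang ar).Relations (ar.get i) := ⟨i, rfl⟩

/-- The symbols for the truth values, the equality and the relations have their standard meaning,
where the true statements are those with the value `trueVal`. -/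
structure IsStandard (I : Interpretation (signature ar q))
    [(relLang ar).Structure (I.carrier .primary)] : Prop where
  falseVal_ne : falseVal I ≠ trueVal I
  impVal_iff : ∀ a b, impVal I a b = trueVal I ↔ (a = trueVal I → b = trueVal I)
  eqVal_iff : ∀ a b, eqVal I a b = trueVal I ↔ a = b
  relVal_iff : ∀ i x, relVal I i x = trueVal I ↔
    Structure.RelMap (relSymbol i) x

/-- All the equations of the list hold under all assignments. -/
def Satisfies (I : Interpretation (signature ar q))
    (l : List (TermPair (signature ar q) (List.replicate (q + 2) .primary))) : Prop :=
  ∀ E ∈ l, ∀ e : ℕ → I.carrier .primary, value I e E.lhs = value I e E.rhs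

theorem realize_varIndex {M : Type} [(relLang ar).Structure M] {n : ℕ} (e : ℕ → M)
    (t : (relLang ar).Term (Empty ⊕ Fin n)) :
    t.realize (Sum.elim default fun i : Fin n => e i) = e (varIndex t) := by
  match t with
  | .var (.inl e) => exact e.elim
  | .var (.inr i) => rfl
  | .func f _ => exact Empty.elim f

theorem snoc_eq_update {M : Type} (e : ℕ → M) (n : ℕ) (a : M) :
    (Fin.snoc (fun i : Fin n => e i) a : Fin (n + 1) → M) =
      fun i : Fin (n + 1) => Function.update e n a i := by
  ext i
  refine Fin.lastCases ?_ (fun i => ?_) i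
  · simp
  · simp [Function.update_of_ne i.2.ne]

/-- The terms for the formulas have the right truth values. For a universal statement, the equations
turn the truth value at the chosen counterexample into the truth value everywhere. -/
theorem value_formulaTerm [(relLang ar).Structure (I.carrier .primary)] (hI : IsStandard I)
    {n : ℕ} (φ : (relLang ar).BoundedFormula Empty n) (k : ℕ)
    (h : n + (quantifiers φ).length ≤ q) (h' : k + (quantifiers φ).length ≤ q)
    (hE : Satisfies I (formulaEquations φ k h h')) (e : ℕ → I.carrier .primary) :
    value I e (formulaTerm φ k h h') = trueVal I ↔
      φ.Realize default fun i : Fin n => e i := by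
  induction φ generalizing k e with
  | falsum =>
    rw [formulaTerm, value_falseTerm]
    exact iff_false_intro hI.falseVal_ne
  | equal t₁ t₂ =>
    rw [formulaTerm, value_eqTerm, hI.eqVal_iff, value_varTerm, value_varTerm,
      ← realize_varIndex e t₁, ← realize_varIndex e t₂]
    rfl
  | @rel n l R ts =>
    obtain ⟨i, rfl⟩ := R
    simp only [formulaTerm, value_relTerm, hI.relVal_iff, value_varTerm, BoundedFormula.Realize,
      realize_varIndex]
    rfl
  | imp φ₁ φ₂ ih₁ ih₂ =>
    rw [formulaTerm, value_impTerm, hI.impVal_iff,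
      ih₁ _ _ _ fun E hE' => hE E (List.mem_append_left _ hE'),
      ih₂ _ _ _ fun E hE' => hE E (List.mem_append_right _ hE')]
    rfl
  | @all n φ ih =>
    have e1 : (quantifiers φ.all).length = (quantifiers φ).length + 1 := by simp [quantifiers]
    have hk : k + (quantifiers φ).length < q := by omega
    have hn : n + 1 + (quantifiers φ).length ≤ q := by omega
    have hscope : ∀ e : ℕ → I.carrier .primary, scopeVal I _ hk (fun i => e i) = trueVal I ↔
        φ.Realize default fun i : Fin (n + 1) => e i := fun e => by
      rw [← value_scopeTerm, ← ih k hn hk.le (fun E hE' => hE E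
        (List.mem_cons_of_mem _ (List.mem_cons_of_mem _ hE'))) e]
      exact Eq.congr_left (hE _ List.mem_cons_self e)
    rw [formulaTerm, value_instanceTerm]
    simp only [BoundedFormula.Realize, snoc_eq_update]
    refine ⟨fun hw a => ?_, fun ha => (hscope _).2 (ha _)⟩
    -- The second equation, with the value `a` for the variable `x_q`.
    have h2 := hE _ (List.mem_cons_of_mem _ List.mem_cons_self) (Function.update e q a)
    have hlow : (fun i : Fin q => Function.update e q a i) = fun i : Fin q => e i :=
      funext fun i => Function.update_of_ne i.2.ne _ _
    have hnq : n ≠ q := by omega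
    have hlow' : ∀ b, (fun i : Fin q => Function.update (Function.update e q a) n b i) =
        fun i : Fin q => Function.update e n b i := fun b => funext fun i => by
      rw [Function.update_comm hnq.symm, Function.update_of_ne i.2.ne]
    simp only [value_impTerm, value_instanceTerm, value_trueTerm, hI.impVal_iff, value_varTerm,
      Function.update_self, hlow', value_witnessTerm, hlow] at h2
    rw [value_witnessTerm] at hw
    exact (hscope _).1 (h2 hw)

/-- An environment that extends a tuple. -/
noncomputable def extend {M : Type} [Nonempty M] {k : ℕ} (x : Fin k → M) (i : ℕ) : M :=
  if h : i < k then x ⟨i, h⟩ else Classical.arbitrary M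

theorem extend_of_lt {M : Type} [Nonempty M] {k : ℕ} (x : Fin k → M) {i : ℕ} (h : i < k) :
    extend x i = x ⟨i, h⟩ :=
  dif_pos h

/-- The truth value of the scope of a quantifier. -/
def ScopeHolds {M : Type} [(relLang ar).Structure M]
    (θ : Σ n, (relLang ar).BoundedFormula Empty (n + 1)) (e : ℕ → M) : Prop :=
  θ.2.Realize default fun i => e i

/-- A counterexample to the scope of a quantifier, if there is one. -/
noncomputable def counterexample {M : Type} [Nonempty M] [(relLang ar).Structure M]
    (θ : Σ n, (relLang ar).BoundedFormula Empty (n + 1)) (e : ℕ → M) : M :=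
  Classical.epsilon fun a => ¬ ScopeHolds θ (Function.update e θ.1 a)

/-- The symbols for the `k`-th quantifier mean what they should, if `θ` is its scope. -/
def QuantifierStandard (I : Interpretation (signature ar q)) [Nonempty (I.carrier .primary)]
    [(relLang ar).Structure (I.carrier .primary)]
    (k : ℕ) (θ : Σ n, (relLang ar).BoundedFormula Empty (n + 1)) : Prop :=
  ∀ (hk : k < q) (x : Fin q → I.carrier .primary),
    (scopeVal I k hk x = trueVal I ↔ ScopeHolds θ (extend x)) ∧
      witnessVal I k hk x = counterexample θ (extend x)

/-- Only the variables `x_0, …, x_n` matter for the scope of `∀ x_n`. -/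
theorem scopeHolds_congr {M : Type} [(relLang ar).Structure M]
    {θ : Σ n, (relLang ar).BoundedFormula Empty (n + 1)} {e e' : ℕ → M}
    (h : ∀ i ≤ θ.1, e i = e' i) : ScopeHolds θ e ↔ ScopeHolds θ e' := by
  have : (fun i : Fin (θ.1 + 1) => e i) = fun i : Fin (θ.1 + 1) => e' i :=
    funext fun i => h _ (by omega)
  rw [ScopeHolds, this, ScopeHolds]

/-- The equations for the quantifiers hold if all the symbols have their standard meaning. -/
theorem satisfies_formulaEquations [Nonempty (I.carrier .primary)]
    [(relLang ar).Structure (I.carrier .primary)] (hI : IsStandard I)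
    (htwo : ∀ a b : I.carrier .bool, (a = trueVal I ↔ b = trueVal I) → a = b)
    {n : ℕ} (φ : (relLang ar).BoundedFormula Empty n) (k : ℕ)
    (h : n + (quantifiers φ).length ≤ q) (h' : k + (quantifiers φ).length ≤ q)
    (hQ : ∀ j θ, (quantifiers φ)[j]? = some θ → QuantifierStandard I (k + j) θ) :
    Satisfies I (formulaEquations φ k h h') := by
  induction φ generalizing k with
  | falsum => exact fun E hE => absurd hE List.not_mem_nil
  | equal => exact fun E hE => absurd hE List.not_mem_nil
  | rel => exact fun E hE => absurd hE List.not_mem_nil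
  | imp φ₁ φ₂ ih₁ ih₂ =>
    intro E hE
    rcases List.mem_append.1 hE with hE | hE
    · refine ih₁ _ _ _ (fun j θ hj => ?_) E hE
      rw [Nat.add_assoc]
      refine hQ _ θ ?_
      rw [quantifiers, List.getElem?_append_right (by omega)]
      simpa using hj
    · refine ih₂ _ _ _ (fun j θ hj => hQ _ θ ?_) E hE
      rw [quantifiers, List.getElem?_append_left (lt_of_lookup hj), hj]
  | @all n φ ih =>
    have e1 : (quantifiers φ.all).length = (quantifiers φ).length + 1 := by simp [quantifiers]
    have hk : k + (quantifiers φ).length < q := by omega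
    have hn : n + 1 + (quantifiers φ).length ≤ q := by omega
    have hφ : Satisfies I (formulaEquations φ k hn hk.le) := by
      refine ih k hn hk.le fun j θ hj => hQ j θ ?_
      rw [quantifiers, List.getElem?_append_left (lt_of_lookup hj), hj]
    have hθ : QuantifierStandard I (k + (quantifiers φ).length) ⟨n, φ⟩ :=
      hQ _ _ (by simp [quantifiers])
    have hscope : ∀ e : ℕ → I.carrier .primary, scopeVal I _ hk (fun i => e i) = trueVal I ↔
        ScopeHolds ⟨n, φ⟩ e := fun e =>
      ((hθ hk _).1).trans (scopeHolds_congr fun i hi => extend_of_lt _ (by simp only at hi; omega))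
    intro E hE e
    rcases List.mem_cons.1 hE with rfl | hE
    · refine htwo _ _ ?_
      rw [value_scopeTerm, hscope, value_formulaTerm hI φ k hn hk.le hφ e]
      rfl
    rcases List.mem_cons.1 hE with rfl | hE
    · simp only [value_impTerm, value_trueTerm, hI.impVal_iff, value_instanceTerm, hscope]
      intro hw
      by_contra hcon
      rw [value_witnessTerm, (hθ hk _).2] at hw
      have hext : ∀ a, ScopeHolds ⟨n, φ⟩ (Function.update e n a) ↔
          ScopeHolds ⟨n, φ⟩ (Function.update (extend fun i : Fin q => e i) n a) := fun a =>
        scopeHolds_congr fun i hi => by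
          rcases eq_or_ne i n with rfl | hin
          · simp
          · rw [Function.update_of_ne hin, Function.update_of_ne hin,
              extend_of_lt _ (by simp only at hi; omega)]
      -- The chosen element refutes the scope, because the value of `x_q` does.
      rw [hext] at hw hcon
      exact Classical.epsilon_spec
        (p := fun a => ¬ ScopeHolds ⟨n, φ⟩ (Function.update (extend fun i : Fin q => e i) n a))
        ⟨_, hcon⟩ hw
    · exact hφ E hE e

/-- The assignments of the `q + 2` variables are the restrictions of the sequences of elements, so
that the model property can be stated with `value`. -/
theorem isModel_translate_iff {ψ : (relLang ar).Sentence}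
    {I : Interpretation (signature ar (quantifiers ψ).length)} :
    (translate ar ψ).IsModel I ↔
      (∀ e, value I e (formulaTerm ψ 0 (by omega) (by omega)) = trueVal I) ∧
      Satisfies I logicEquations ∧
      Satisfies I (formulaEquations ψ 0 (by omega) (by omega)) ∧
      trueVal I ≠ falseVal I := by
  have : Nonempty (I.carrier .primary) := I.nonempty_carrier _
  constructor
  · intro hI
    have hI' := fun e : ℕ → I.carrier .primary => hI (uniformArgs fun i => e i)
    refine ⟨fun e => ?_, fun E hE e => ?_, fun E hE e => ?_, ?_⟩
    · exact ((hI' e).1 _ List.mem_cons_self).trans (value_trueTerm e)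
    · exact (hI' e).1 E (List.mem_cons_of_mem _ (List.mem_append_left _ hE))
    · exact (hI' e).1 E (List.mem_cons_of_mem _ (List.mem_append_right _ hE))
    · have e : ℕ → I.carrier .primary := Classical.arbitrary _
      rw [← value_trueTerm e, ← value_falseTerm e]
      exact (hI' e).2 _ List.mem_cons_self
  · rintro ⟨h1, h2, h3, h4⟩ a
    obtain ⟨e, rfl⟩ : ∃ e : ℕ → I.carrier .primary, a = uniformArgs fun i => e i := by
      obtain ⟨x, rfl⟩ := uniformArgs.surjective a
      exact ⟨extend x, congrArg uniformArgs (funext fun i => (extend_of_lt x i.2).symm)⟩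
    refine ⟨fun E hE => ?_, fun E hE => ?_⟩
    · rcases List.mem_cons.1 hE with rfl | hE
      · exact (h1 e).trans (value_trueTerm e).symm
      · rcases List.mem_append.1 hE with hE | hE
        · exact h2 E hE e
        · exact h3 E hE e
    · obtain rfl := List.mem_singleton.1 hE
      exact fun h => h4 ((value_trueTerm e).symm.trans (h.trans (value_falseTerm e)))

/-- The equations of `logicEquations` as statements about the functions of the interpretation. -/
theorem satisfies_logicEquations_iff :
    Satisfies I logicEquations ↔
      impVal I (trueVal I) (trueVal I) = trueVal I ∧
      impVal I (trueVal I) (falseVal I) = falseVal I ∧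
      impVal I (falseVal I) (trueVal I) = trueVal I ∧
      impVal I (falseVal I) (falseVal I) = trueVal I ∧
      (∀ a, eqVal I a a = trueVal I) ∧
      (∀ a b, selectVal I (trueVal I) a b = a) ∧
      (∀ a b, selectVal I (eqVal I a b) a b = b) := by
  have : Nonempty (I.carrier .primary) := I.nonempty_carrier _
  have h1 : ∀ P : I.carrier .primary → Prop, (∀ e : ℕ → I.carrier .primary, P (e 0)) ↔ ∀ a, P a :=
    fun P => ⟨fun h a => h fun _ => a, fun h e => h _⟩
  have h2 : ∀ P : I.carrier .primary → I.carrier .primary → Prop,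
      (∀ e : ℕ → I.carrier .primary, P (e 0) (e 1)) ↔ ∀ a b, P a b :=
    fun P => ⟨fun h a b => h fun i => if i = 0 then a else b, fun h e => h _ _⟩
  simp only [Satisfies, logicEquations, List.forall_mem_cons, value_impTerm, value_trueTerm,
    value_falseTerm, value_eqTerm, value_selectTerm, value_varTerm, forall_const,
    h1 fun a => eqVal I a a = trueVal I, h2 fun a b => selectVal I (trueVal I) a b = a,
    h2 fun a b => selectVal I (eqVal I a b) a b = b]
  simp

end Semantics

/-! ### From a model of the system to a model of the sentence -/

section ModelOfSystem

open FirstOrder.Language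

variable {ar : List ℕ} {q : ℕ}

/-- The first-order structure on the primary sort of an interpretation, in which a relation holds
where its characteristic function is true. -/
@[reducible]
def Interpretation.toStructure (I : Interpretation (signature ar q)) :
    (relLang ar).Structure (I.carrier .primary) where
  funMap f := Empty.elim f
  RelMap R x := relVal I R.1 (fun j => x (j.cast R.2)) = trueVal I

theorem eq_or_eq_of_card_eq_two {α : Type} (hcard : Nat.card α = 2) {a b : α} (hne : a ≠ b)
    (c : α) : c = a ∨ c = b := by
  obtain ⟨x, y, -, hxy⟩ := Nat.card_eq_two_iff.1 hcard
  have hmem : ∀ d : α, d = x ∨ d = y := fun d => by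
    simpa [← hxy] using Set.mem_univ d
  rcases hmem a with rfl | rfl <;> rcases hmem b with rfl | rfl <;> rcases hmem c with rfl | rfl <;>
    simp_all

/-- In a model of the system all the symbols but those for the quantifiers are standard. If the
truth value of `a = b` is true, the equations for the selection function give `a = b`. -/
theorem isStandard_toStructure {I : Interpretation (signature ar q)}
    (hcard : Nat.card (I.carrier .bool) = 2) (hne : trueVal I ≠ falseVal I)
    (hlogic : Satisfies I logicEquations) :
    @IsStandard ar q I I.toStructure := by
  obtain ⟨htt, htf, hft, hff, heq, hselect, hselect'⟩ := satisfies_logicEquations_iff.1 hlogic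
  let := I.toStructure
  refine ⟨hne.symm, fun a b => ?_, fun a b => ⟨fun h => ?_, ?_⟩, fun i x => Iff.rfl⟩
  · rcases eq_or_eq_of_card_eq_two hcard hne a with rfl | rfl <;>
      rcases eq_or_eq_of_card_eq_two hcard hne b with rfl | rfl <;>
      simp [htt, htf, hft, hff, hne.symm]
  · have := hselect' a b
    rwa [h, hselect] at this
  · rintro rfl
    exact heq a

theorem hasModelOfSize_of_isModel {ψ : (relLang ar).Sentence}
    {I : Interpretation (signature ar (quantifiers ψ).length)} (hI : (translate ar ψ).IsModel I)
    (hcard : Nat.card (I.carrier .bool) = 2) :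
    HasModelOfSize ψ (Nat.card (I.carrier .primary)) := by
  obtain ⟨htrue, hlogic, hquant, hne⟩ := isModel_translate_iff.1 hI
  have : Nonempty (I.carrier .primary) := I.nonempty_carrier _
  let := I.toStructure
  refine ⟨I.carrier .primary, this, rfl, ?_⟩
  have e : ℕ → I.carrier .primary := Classical.arbitrary _
  have h := (value_formulaTerm (isStandard_toStructure hcard hne hlogic) ψ 0 _ _ hquant e).1
    (htrue e)
  rwa [Subsingleton.elim (fun i : Fin 0 => e i) default] at h

end ModelOfSystem

/-! ### From a model of the sentence to a model of the system -/

section ModelOfSentence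

open FirstOrder.Language Classical

variable {ar : List ℕ}

/-- A function whose arguments all have the same sort, together with its sorts. -/
def uniformMap {C : TwoSort → Type} {k : ℕ} {s t : TwoSort} (F : (Fin k → C s) → C t) :
    Σ p, SortedMap C p :=
  ⟨(List.replicate k s, t), fun y => F (uniformArgs.symm y)⟩

theorem fnUniform_ofList {S : Signature TwoSort} {C : TwoSort → Type} {hC : ∀ s, Finite (C s)}
    {hC' : ∀ s, Nonempty (C s)} {L : List (Σ p, SortedMap C p)} {h : L.map Sigma.fst = S}
    {f k : ℕ} {s t : TwoSort} {F : (Fin k → C s) → C t} (hF : L[f]? = some (uniformMap F))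
    (hf : S[f]? = some (List.replicate k s, t)) (x : Fin k → C s) :
    (Interpretation.ofList C hC hC' L h).fnUniform hf x = F x :=
  (congrFun (Interpretation.fn_ofList C hC hC' L h _ hF hf) _).trans
    (congrArg F (uniformArgs.symm_apply_apply x))

/-- The domains of the model of the system of a sentence. -/
abbrev domains (M : Type) : TwoSort → Type
  | .primary => M
  | .bool => Bool

/-- If-then-else, as a function for the selection symbol. -/
def selection (M : Type) :
    SortedMap (domains M) ([.bool, .primary, .primary], .primary) :=
  fun y => cond (y ⟨0, by decide⟩) (y ⟨1, by decide⟩) (y ⟨2, by decide⟩)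

variable (M : Type) [Nonempty M] [(relLang ar).Structure M]

/-- The functions of the model of the system of a sentence, in the order of the signature. -/
noncomputable def functions (ψ : (relLang ar).Sentence) : List (Σ p, SortedMap (domains M) p) :=
  (List.ofFn fun i : Fin ar.length => uniformMap (C := domains M) (s := .primary) (t := .bool)
      fun x : Fin (ar.get i) → M => decide (Structure.RelMap (relSymbol i) x)) ++
    ([uniformMap (C := domains M) (k := 0) (s := .primary) (t := .bool) fun _ => true,
      uniformMap (C := domains M) (k := 0) (s := .primary) (t := .bool) fun _ => false,
      uniformMap (C := domains M) (k := 2) (s := .bool) (t := .bool) fun x => !x 0 || x 1,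
      uniformMap (C := domains M) (k := 2) (s := .primary) (t := .bool)
        fun x => decide (x 0 = x 1),
      ⟨_, selection M⟩] ++
    ((quantifiers ψ).map (fun θ => uniformMap (C := domains M) (k := (quantifiers ψ).length)
        (s := .primary) (t := .bool) fun x => decide (ScopeHolds θ (extend x))) ++
      (quantifiers ψ).map (fun θ => uniformMap (C := domains M) (k := (quantifiers ψ).length)
        (s := .primary) (t := .primary) fun x => counterexample θ (extend x))))

theorem map_fst_functions (ψ : (relLang ar).Sentence) :
    (functions M ψ).map Sigma.fst = signature ar (quantifiers ψ).length := by
  simp only [functions, signature, charSymbols, List.map_append, List.map_map, List.map_ofFn,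
    Function.comp_def, uniformMap, List.map_const']
  congr 1
  exact List.ofFn_getElem_eq_map ar fun k => (List.replicate k TwoSort.primary, TwoSort.bool)

/-- The model of the system of a sentence that a model of the sentence gives. -/
noncomputable def standardModel [Finite M] (ψ : (relLang ar).Sentence) :
    Interpretation (signature ar (quantifiers ψ).length) :=
  .ofList (domains M) (by rintro (_ | _) <;> infer_instance) (by rintro (_ | _) <;> infer_instance)
    (functions M ψ) (map_fst_functions M ψ)

variable {M}

theorem standardModel_trueVal [Finite M] (ψ : (relLang ar).Sentence) :
    trueVal (standardModel M ψ) = true := by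
  refine fnUniform_ofList (C := domains M) (s := .primary) (t := .bool)
    (F := fun _ => true) ?_ _ _
  rw [functions, List.getElem?_append_right (by simp)]
  simp

theorem standardModel_falseVal [Finite M] (ψ : (relLang ar).Sentence) :
    falseVal (standardModel M ψ) = false := by
  refine fnUniform_ofList (C := domains M) (s := .primary) (t := .bool)
    (F := fun _ => false) ?_ _ _
  rw [functions, List.getElem?_append_right (by simp)]
  simp

theorem standardModel_impVal [Finite M] (ψ : (relLang ar).Sentence) (a b : Bool) :
    impVal (standardModel M ψ) a b = (!a || b) := by
  refine fnUniform_ofList (C := domains M) (s := .bool) (t := .bool)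
    (F := fun x => !x 0 || x 1) ?_ _ _
  rw [functions, List.getElem?_append_right (by simp)]
  simp

theorem standardModel_eqVal [Finite M] (ψ : (relLang ar).Sentence) (a b : M) :
    eqVal (standardModel M ψ) a b = decide (a = b) := by
  refine fnUniform_ofList (C := domains M) (s := .primary) (t := .bool)
    (F := fun x => decide (x 0 = x 1)) ?_ _ _
  rw [functions, List.getElem?_append_right (by simp)]
  simp

theorem standardModel_selectVal [Finite M] (ψ : (relLang ar).Sentence) (c : Bool) (a b : M) :
    selectVal (standardModel M ψ) c a b = cond c a b := by
  refine congrFun (Interpretation.fn_ofList (domains M) _ _ _ _ (selection M) ?_ _) _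
  rw [functions, List.getElem?_append_right (by simp)]
  simp

theorem standardModel_relVal [Finite M] (ψ : (relLang ar).Sentence) (i : Fin ar.length)
    (x : Fin (ar.get i) → M) :
    relVal (standardModel M ψ) i x = decide (Structure.RelMap (relSymbol i) x) := by
  refine fnUniform_ofList (C := domains M) (s := .primary) (t := .bool)
    (F := fun x => decide (Structure.RelMap (relSymbol i) x)) ?_ _ _
  rw [functions, List.getElem?_append_left (by simp)]
  simp

theorem standardModel_scopeVal [Finite M] (ψ : (relLang ar).Sentence) {k : ℕ}
    (hk : k < (quantifiers ψ).length) {θ : Σ n, (relLang ar).BoundedFormula Empty (n + 1)}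
    (hθ : (quantifiers ψ)[k]? = some θ) (x : Fin (quantifiers ψ).length → M) :
    scopeVal (standardModel M ψ) k hk x = decide (ScopeHolds θ (extend x)) := by
  refine fnUniform_ofList (C := domains M) (s := .primary) (t := .bool)
    (F := fun x => decide (ScopeHolds θ (extend x))) ?_ _ _
  rw [functions, List.getElem?_append_right (by simp), List.getElem?_append_right (by simp),
    List.getElem?_append_left (by simpa using hk)]
  simp [hθ]

theorem standardModel_witnessVal [Finite M] (ψ : (relLang ar).Sentence) {k : ℕ}
    (hk : k < (quantifiers ψ).length) {θ : Σ n, (relLang ar).BoundedFormula Empty (n + 1)}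
    (hθ : (quantifiers ψ)[k]? = some θ) (x : Fin (quantifiers ψ).length → M) :
    witnessVal (standardModel M ψ) k hk x = counterexample θ (extend x) := by
  refine fnUniform_ofList (C := domains M) (s := .primary) (t := .primary)
    (F := fun x => counterexample θ (extend x)) ?_ _ _
  rw [functions, List.getElem?_append_right (by simp), List.getElem?_append_right (by simp),
    List.getElem?_append_right (by simp)]
  simp [hθ]

/-- The primary sort of the model is the domain of the first-order structure. -/
instance [Finite M] (ψ : (relLang ar).Sentence) :
    (relLang ar).Structure ((standardModel M ψ).carrier .primary) :=
  inferInstanceAs ((relLang ar).Structure M)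

instance [Finite M] (ψ : (relLang ar).Sentence) :
    Nonempty ((standardModel M ψ).carrier .primary) :=
  inferInstanceAs (Nonempty M)

/-- Truth in the model is truth in `Bool`. -/
theorem standardModel_eq_trueVal_iff [Finite M] (ψ : (relLang ar).Sentence) {b : Bool} {p : Prop}
    (h : b = true ↔ p) :
    (b : (standardModel M ψ).carrier .bool) = trueVal (standardModel M ψ) ↔ p := by
  rw [standardModel_trueVal]
  exact h

theorem isStandard_standardModel [Finite M] (ψ : (relLang ar).Sentence) :
    IsStandard (standardModel M ψ) where
  falseVal_ne := by
    rw [standardModel_trueVal, standardModel_falseVal]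
    exact Bool.false_ne_true
  impVal_iff a b := by
    have hb : ∀ a b : Bool, (!a || b) = true ↔ (a = true → b = true) := by decide
    refine standardModel_eq_trueVal_iff (M := M) ψ ?_
    rw [standardModel_trueVal]
    exact (Eq.congr_left (standardModel_impVal ψ a b)).trans (hb a b)
  eqVal_iff a b := standardModel_eq_trueVal_iff (M := M) ψ
    ((Eq.congr_left (standardModel_eqVal (M := M) ψ a b)).trans decide_eq_true_iff)
  relVal_iff i x := standardModel_eq_trueVal_iff (M := M) ψ
    ((Eq.congr_left (standardModel_relVal (M := M) ψ i x)).trans decide_eq_true_iff)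

theorem isModel_standardModel [Finite M] (ψ : (relLang ar).Sentence) (hψ : M ⊨ ψ) :
    (translate ar ψ).IsModel (standardModel M ψ) := by
  have hI := isStandard_standardModel (M := M) ψ
  have hquant : Satisfies (standardModel M ψ)
      (formulaEquations ψ 0 (by omega) (by omega)) := by
    refine satisfies_formulaEquations hI ?_ ψ 0 _ _ fun j θ hj hk x => ?_
    · rw [standardModel_trueVal]
      exact fun a b h => Bool.eq_iff_iff.2 h
    · rw [← Nat.zero_add j] at hj
      exact ⟨standardModel_eq_trueVal_iff (M := M) ψ
        ((Eq.congr_left (standardModel_scopeVal (M := M) ψ hk hj x)).trans decide_eq_true_iff),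
        standardModel_witnessVal (M := M) ψ hk hj x⟩
  refine isModel_translate_iff.2 ⟨fun e => ?_, satisfies_logicEquations_iff.2
    ⟨?_, ?_, ?_, ?_, fun a => (hI.eqVal_iff a a).2 rfl, fun a b => ?_, fun a b => ?_⟩, hquant,
    hI.falseVal_ne.symm⟩
  · rw [value_formulaTerm hI ψ 0 _ _ hquant e, Subsingleton.elim (fun i : Fin 0 => e i) default]
    exact hψ
  · rw [standardModel_trueVal]
    exact standardModel_impVal ψ true true
  · rw [standardModel_trueVal, standardModel_falseVal]
    exact standardModel_impVal ψ true false
  · rw [standardModel_trueVal, standardModel_falseVal]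
    exact standardModel_impVal ψ false true
  · rw [standardModel_trueVal, standardModel_falseVal]
    exact standardModel_impVal ψ false false
  · rw [standardModel_trueVal]
    exact standardModel_selectVal (M := M) ψ true a b
  · refine (standardModel_selectVal (M := M) ψ _ a b).trans ?_
    rw [standardModel_eqVal (M := M) ψ a b]
    exact (Bool.cond_decide ..).trans (ite_eq_right_iff.2 id)

end ModelOfSentence

end TermCoding

theorem mainTheorem6 :
    ∃ Γ : (ar : List ℕ) → (TermCoding.relLang ar).Sentence →
        TermCoding.TermCodingSystem TermCoding.TwoSort,
      TermCoding.IsEffective Γ ∧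
      ∀ (ar : List ℕ) (ψ : (TermCoding.relLang ar).Sentence),
        TermCoding.charSymbols ar <+: (Γ ar ψ).sig ∧
        ∀ n : ℕ, 2 ≤ n →
          (TermCoding.HasModelOfSize ψ n ↔
            ∃ I : TermCoding.Interpretation (Γ ar ψ).sig,
              (Γ ar ψ).IsModel I ∧
              Nat.card (I.carrier TermCoding.TwoSort.primary) = n ∧
              Nat.card (I.carrier TermCoding.TwoSort.bool) = 2) := by
  refine ⟨TermCoding.translate, TermCoding.isEffective_translate,
    fun ar ψ => ⟨List.prefix_append _ _, fun n hn => ?_⟩⟩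
  constructor
  · rintro ⟨M, hM, hcard, hψ⟩
    have : Nonempty M := (Nat.card_pos_iff.1 (by omega)).1
    have : Finite M := (Nat.card_pos_iff.1 (by omega)).2
    have hbool : Nat.card Bool = 2 := by simp
    exact ⟨TermCoding.standardModel M ψ, TermCoding.isModel_standardModel ψ hψ, hcard, hbool⟩
  · rintro ⟨I, hI, rfl, hbool⟩
    exact TermCoding.hasModelOfSize_of_isModel hI hbool
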